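/- Let $p$ be an odd prime and let $\mathbb{Z}_p$ be the ring of $p$-adic integers. For $k\ge 1$ let $H_k=\sum_{j=1}^{k}1/j$ be the $k$-th harmonic number and $C_k=\frac{1}{k+1}\binom{2k}{k}$ the $k$-th Catalan number, and let $\pounds_1(t)=\sum_{k=1}^{p-1}t^k/k$. Let $\beta$ be an indeterminate, and put $\alpha=1-\beta$ and $x=\beta(1-\beta)$. Then both sides of each of the following congruences, computed in the field of rational functions $\mathbb{Q}_p(\beta)$, lie in the polynomial ring $\mathbb{Z}_p[\beta]$, and the congruences hold in $\mathbb{Z}_p[\beta]$ (that is, the difference of the two sides lies in $p\,\mathbb{Z}_p[\beta]$): $$\sum_{k=1}^{p-1}\binom{2k}{k}H_k\,x^k\equiv -2(\alpha-\beta)^{p-1}\,\pounds_1\!\left(\frac{\beta}{\beta-\alpha}\right)\pmod p,$$ $$\sum_{k=1}^{p-1}C_kH_k\,x^{k+1}\equiv \pounds_1(\beta)+(\alpha-\beta)^{p+1}\,\pounds_1\!\left(\frac{\beta}{\beta-\alpha}\right)\pmod p.$$ -/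

import Mathlib

open Finset Polynomial

/-- The finite polylogarithm `£_d(x) = ∑_{k=1}^{p-1} x^k / k^d`, evaluated in a field `K`
(used below only in characteristic zero, so that no denominator vanishes). -/
def finitePolylog {K : Type*} [Field K] (p d : ℕ) (x : K) : K :=
  ∑ k ∈ Icc 1 (p - 1), x ^ k / (k : K) ^ d

/-- The natural embedding of the polynomial ring `ℤ_p[β]` in the field `ℚ_p(β)`. -/
noncomputable def padicPolyEmb (p : ℕ) [Fact p.Prime] : ℤ_[p][X] →+* RatFunc ℚ_[p] :=
  (algebraMap ℚ_[p][X] (RatFunc ℚ_[p])).comp (Polynomial.mapRingHom (algebraMap ℤ_[p] ℚ_[p]))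

/-- `A ≡ B (mod p)` in `ℤ_p[β]`, for expressions `A`, `B` written in `ℚ_p(β)`:
both are polynomials with coefficients in `ℤ_p`, and as such their difference is
divisible by `p` in `ℤ_p[β]`. -/
def PolyCongr (p : ℕ) [Fact p.Prime] (A B : RatFunc ℚ_[p]) : Prop :=
  ∃ a b : ℤ_[p][X], padicPolyEmb p a = A ∧ padicPolyEmb p b = B ∧ (p : ℤ_[p][X]) ∣ a - b

/-! With `s = 1 - 2X` and `1/j` in `ℤ_p` for `j < p`, both sides come from polynomials over `ℤ_p`;
multiplying by `s ^ (p - 1)` clears the denominators of `£₁(β/(β-α)) = £₁(-X/s)`. It remains to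
prove two identities over `ZMod p`. Write `F`, `E`, `L`, `G` for the central binomial sum, the
Catalan sum, the polylogarithm and its homogenised form.

In characteristic `p`, a polynomial with zero derivative is a polynomial in `X ^ p`; if its degree
is below `2p`, it is `a X ^ p + b`, hence zero once it vanishes at `0` and `1`. This applies to `s
(F + 2G)` (`centralBinomHarmonicPoly_eq`) and to `E - L - s² G` (`catalanHarmonicPoly_eq`). The
derivatives come from first-order differential equations for `F`, `G` and `L`, from `E' = s F`, and
from `s ^ p = 1 - 2 X ^ p`. -/

section Polynomials

/-! ### Polynomials over a general ring, to be compared over `ℤ_p` and `ZMod p`. -/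

variable {R S : Type*} [CommRing R] [CommRing S]

/-- The `k`-th harmonic number, with `u j` playing the role of `1 / j`. -/
def harmonicOf (u : ℕ → R) (k : ℕ) : R := ∑ j ∈ Icc 1 k, u j

/-- The polynomial `∑ binom(2k, k) H_k (X (1 - X)) ^ k`. -/
noncomputable def centralBinomHarmonicPoly (n : ℕ) (u : ℕ → R) : R[X] :=
  ∑ k ∈ Icc 1 n, C (((2 * k).choose k : ℕ) * harmonicOf u k) * (X * (1 - X)) ^ k

/-- The polynomial `∑ C_k H_k (X (1 - X)) ^ (k + 1)`. -/
noncomputable def catalanHarmonicPoly (n : ℕ) (u : ℕ → R) : R[X] :=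
  ∑ k ∈ Icc 1 n, C ((catalan k : ℕ) * harmonicOf u k) * (X * (1 - X)) ^ (k + 1)

/-- The truncated logarithm `∑ X ^ k / k`. -/
noncomputable def polylogPoly (n : ℕ) (u : ℕ → R) : R[X] :=
  ∑ k ∈ Icc 1 n, C (u k) * X ^ k

/-- The truncated logarithm at `-X / (1 - 2 X)`, multiplied by `(1 - 2 X) ^ n`. -/
noncomputable def homogPolylogPoly (n : ℕ) (u : ℕ → R) : R[X] :=
  ∑ k ∈ Icc 1 n, C (u k) * ((-X) ^ k * (1 - 2 * X) ^ (n - k))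

lemma map_harmonicOf (f : R →+* S) (u : ℕ → R) (v : ℕ → S) (n k : ℕ) (hk : k ≤ n)
    (h : ∀ j ∈ Icc 1 n, f (u j) = v j) : f (harmonicOf u k) = harmonicOf v k := by
  rw [harmonicOf, map_sum]
  exact Finset.sum_congr rfl fun j hj => h j (Finset.Icc_subset_Icc_right hk hj)

lemma map_centralBinomHarmonicPoly (f : R →+* S) (u : ℕ → R) (v : ℕ → S) (n : ℕ)
    (h : ∀ j ∈ Icc 1 n, f (u j) = v j) :
    (centralBinomHarmonicPoly n u).map f = centralBinomHarmonicPoly n v := by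
  simp only [centralBinomHarmonicPoly, Polynomial.map_sum]
  refine Finset.sum_congr rfl fun k hk => ?_
  simp [map_harmonicOf f u v n k (Finset.mem_Icc.1 hk).2 h]

lemma map_catalanHarmonicPoly (f : R →+* S) (u : ℕ → R) (v : ℕ → S) (n : ℕ)
    (h : ∀ j ∈ Icc 1 n, f (u j) = v j) :
    (catalanHarmonicPoly n u).map f = catalanHarmonicPoly n v := by
  simp only [catalanHarmonicPoly, Polynomial.map_sum]
  refine Finset.sum_congr rfl fun k hk => ?_
  simp [map_harmonicOf f u v n k (Finset.mem_Icc.1 hk).2 h]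

lemma map_polylogPoly (f : R →+* S) (u : ℕ → R) (v : ℕ → S) (n : ℕ)
    (h : ∀ j ∈ Icc 1 n, f (u j) = v j) :
    (polylogPoly n u).map f = polylogPoly n v := by
  simp only [polylogPoly, Polynomial.map_sum]
  refine Finset.sum_congr rfl fun k hk => ?_
  simp [h k hk]

lemma map_homogPolylogPoly (f : R →+* S) (u : ℕ → R) (v : ℕ → S) (n : ℕ)
    (h : ∀ j ∈ Icc 1 n, f (u j) = v j) :
    (homogPolylogPoly n u).map f = homogPolylogPoly n v := by
  simp only [homogPolylogPoly, Polynomial.map_sum]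
  refine Finset.sum_congr rfl fun k hk => ?_
  simp [h k hk]

lemma natDegree_polylogPoly_le (n : ℕ) (u : ℕ → R) :
    (polylogPoly n u).natDegree ≤ n := by
  refine natDegree_sum_le_of_forall_le _ _ fun k hk => ?_
  exact (natDegree_C_mul_X_pow_le _ _).trans (Finset.mem_Icc.1 hk).2

end Polynomials

/-! ### Binomial and harmonic congruences modulo `p`. -/

section ModP

variable {p : ℕ} [Fact p.Prime]

lemma ZMod.natCast_ne_zero_of_pos_of_lt {k : ℕ} (h0 : 0 < k) (hk : k < p) :
    (k : ZMod p) ≠ 0 := by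
  rw [Ne, ZMod.natCast_eq_zero_iff]
  exact Nat.not_dvd_of_pos_of_lt h0 hk

/-- A polynomial of degree less than `2 p` with vanishing derivative is determined by its values
at `0` and `1`. -/
lemma eq_zero_of_derivative_eq_zero {f : (ZMod p)[X]} (hd : derivative f = 0)
    (hdeg : f.natDegree < 2 * p) (h0 : f.eval 0 = 0) (h1 : f.eval 1 = 0) : f = 0 := by
  have hp : p ≠ 0 := (Fact.out : p.Prime).ne_zero
  have he := expand_contract p hd hp
  have hg : (contract p f).natDegree ≤ 1 := by
    rw [← he, natDegree_expand] at hdeg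
    have := Nat.lt_of_mul_lt_mul_right hdeg
    omega
  obtain ⟨a, b, hab⟩ := exists_eq_X_add_C_of_natDegree_le_one hg
  rw [hab] at he
  rw [← he] at h0 h1
  have hb : b = 0 := by simpa [expand_eval, hp] using h0
  have ha : a = 0 := by simpa [expand_eval, hp, hb] using h1
  rw [← he, ha, hb]
  simp

/-- This is `binom(2k, k) = (-4) ^ k binom(-1/2, k)`, with `m = -1/2` modulo `p`. -/
lemma centralBinom_eq_choose_mod {m : ℕ} (hm : p = 2 * m + 1) {k : ℕ} (hk : k < p) :
    (((2 * k).choose k : ℕ) : ZMod p) = (m.choose k : ℕ) * (-4) ^ k := by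
  induction k with
  | zero => simp
  | succ k ih =>
    have hne := ZMod.natCast_ne_zero_of_pos_of_lt (p := p) k.succ_pos hk
    have h1 := congrArg (Nat.cast : ℕ → ZMod p) (Nat.succ_mul_centralBinom_succ k)
    simp only [Nat.centralBinom] at h1
    have hp0 : (2 * (m : ZMod p) + 1) = 0 := by
      have := congrArg (Nat.cast : ℕ → ZMod p) hm
      simpa using this.symm
    have h2 : ((m.choose (k + 1) : ℕ) : ZMod p) * (k + 1) = (m.choose k : ℕ) * (m - k) := by
      rcases le_or_gt k m with hkm | hkm
      · have := congrArg (Nat.cast : ℕ → ZMod p) (Nat.choose_succ_right_eq m k)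
        push_cast [Nat.cast_sub hkm] at this
        exact this
      · simp [Nat.choose_eq_zero_of_lt hkm, Nat.choose_eq_zero_of_lt (hkm.trans k.lt_succ_self)]
    apply mul_left_cancel₀ hne
    push_cast at h1 ⊢
    rw [h1, ih (by omega), pow_succ]
    linear_combination 4 * (-4) ^ k * h2 + 2 * (m.choose k : ZMod p) * (-4) ^ k * hp0

lemma centralBinom_eq_zero_mod {m : ℕ} (hm : p = 2 * m + 1) {k : ℕ} (hmk : m < k) (hk : k < p) :
    (((2 * k).choose k : ℕ) : ZMod p) = 0 := by
  simp [centralBinom_eq_choose_mod hm hk, Nat.choose_eq_zero_of_lt hmk]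

/-- The reflection `k ↦ p - k` changes the sign of the sum, and `2` is invertible. -/
lemma sum_Icc_inv_eq_zero (hp : Odd p) : ∑ k ∈ Icc 1 (p - 1), ((k : ZMod p))⁻¹ = 0 := by
  have hp2 : 2 < p := (Fact.out : p.Prime).two_le.lt_of_ne fun h => absurd hp (by rw [← h]; decide)
  have hne : (2 : ZMod p) ≠ 0 := by
    exact_mod_cast ZMod.natCast_ne_zero_of_pos_of_lt (p := p) two_pos hp2
  have h := Finset.sum_Ico_reflect (fun k => ((k : ZMod p))⁻¹) 1 p.le_succ
  rw [Nat.add_sub_cancel, Nat.add_sub_cancel_left] at h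
  have h' : ∑ k ∈ Ico 1 p, (((p - k : ℕ) : ZMod p))⁻¹ = -∑ k ∈ Ico 1 p, ((k : ZMod p))⁻¹ := by
    rw [← Finset.sum_neg_distrib]
    refine Finset.sum_congr rfl fun k hk => ?_
    rw [Nat.cast_sub (Finset.mem_Ico.1 hk).2.le, ZMod.natCast_self, zero_sub, inv_neg]
  rw [h'] at h
  rw [← Finset.Ico_add_one_right_eq_Icc, Nat.sub_add_cancel (by omega)]
  apply (mul_eq_zero.1 (_ : (2 : ZMod p) * _ = 0)).resolve_left hne
  linear_combination -h

/-! ### Degree bounds and values at `0` and `1`. -/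

lemma natDegree_X_mul_one_sub_X_pow_le (k : ℕ) :
    ((X * (1 - X) : (ZMod p)[X]) ^ k).natDegree ≤ 2 * k := by
  have : (X * (1 - X) : (ZMod p)[X]).natDegree ≤ 2 := by compute_degree
  calc _ ≤ k * (X * (1 - X) : (ZMod p)[X]).natDegree := natDegree_pow_le
    _ ≤ k * 2 := by gcongr
    _ = 2 * k := mul_comm _ _

lemma natDegree_centralBinomHarmonicPoly_le {m : ℕ} (hm : p = 2 * m + 1) :
    (centralBinomHarmonicPoly (p - 1) fun j => ((j : ZMod p))⁻¹).natDegree ≤ p - 1 := by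
  refine natDegree_sum_le_of_forall_le _ _ fun k hk => ?_
  rw [Finset.mem_Icc] at hk
  rcases le_or_gt k m with hkm | hkm
  · exact (natDegree_C_mul_le _ _).trans ((natDegree_X_mul_one_sub_X_pow_le k).trans (by omega))
  · simp [centralBinom_eq_zero_mod hm hkm (by omega)]

lemma natDegree_catalanHarmonicPoly_le {m : ℕ} (hm : p = 2 * m + 1) :
    (catalanHarmonicPoly (p - 1) fun j => ((j : ZMod p))⁻¹).natDegree ≤ p + 1 := by
  refine natDegree_sum_le_of_forall_le _ _ fun k hk => ?_
  rw [Finset.mem_Icc] at hk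
  rcases le_or_gt k m with hkm | hkm
  · exact (natDegree_C_mul_le _ _).trans
      ((natDegree_X_mul_one_sub_X_pow_le (k + 1)).trans (by omega))
  -- For `k = p - 1` the factor `k + 1 = p` cannot be cancelled to kill the Catalan number; the
  -- harmonic number vanishes instead.
  rcases eq_or_ne k (p - 1) with rfl | hkp
  · simp [harmonicOf, sum_Icc_inv_eq_zero ⟨m, hm⟩]
  · have h := congrArg (Nat.cast : ℕ → ZMod p) (succ_mul_catalan_eq_centralBinom k)
    rw [Nat.centralBinom, centralBinom_eq_zero_mod hm hkm (by omega), Nat.cast_mul] at h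
    have hc := (mul_eq_zero.1 h).resolve_left
      (ZMod.natCast_ne_zero_of_pos_of_lt k.succ_pos (by omega))
    simp [hc]

lemma natDegree_homogPolylogPoly_le (n : ℕ) (u : ℕ → ZMod p) :
    (homogPolylogPoly n u).natDegree ≤ n := by
  refine natDegree_sum_le_of_forall_le _ _ fun k hk => ?_
  rw [Finset.mem_Icc] at hk
  refine (natDegree_C_mul_le _ _).trans (natDegree_mul_le.trans ?_)
  have h1 : ((-X : (ZMod p)[X]) ^ k).natDegree ≤ k * 1 :=
    natDegree_pow_le_of_le k (by simp)
  have h2 : ((1 - 2 * X : (ZMod p)[X]) ^ (n - k)).natDegree ≤ (n - k) * 1 :=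
    natDegree_pow_le_of_le _ (by compute_degree)
  omega

lemma eval_centralBinomHarmonicPoly_of_mul_eq_zero {n : ℕ} {u : ℕ → ZMod p} {a : ZMod p}
    (ha : a * (1 - a) = 0) : (centralBinomHarmonicPoly n u).eval a = 0 := by
  rw [centralBinomHarmonicPoly, eval_finsetSum]
  refine Finset.sum_eq_zero fun k hk => ?_
  have : k ≠ 0 := by rw [Finset.mem_Icc] at hk; omega
  simp [ha, this]

lemma eval_catalanHarmonicPoly_of_mul_eq_zero {n : ℕ} {u : ℕ → ZMod p} {a : ZMod p}
    (ha : a * (1 - a) = 0) : (catalanHarmonicPoly n u).eval a = 0 := by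
  rw [catalanHarmonicPoly, eval_finsetSum]
  exact Finset.sum_eq_zero fun k hk => by simp [ha]

lemma eval_zero_homogPolylogPoly (n : ℕ) (u : ℕ → ZMod p) :
    (homogPolylogPoly n u).eval 0 = 0 := by
  rw [homogPolylogPoly, eval_finsetSum]
  refine Finset.sum_eq_zero fun k hk => ?_
  have : k ≠ 0 := by rw [Finset.mem_Icc] at hk; omega
  simp [this]

lemma eval_zero_polylogPoly (n : ℕ) (u : ℕ → ZMod p) : (polylogPoly n u).eval 0 = 0 := by
  rw [polylogPoly, eval_finsetSum]
  refine Finset.sum_eq_zero fun k hk => ?_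
  have : k ≠ 0 := by rw [Finset.mem_Icc] at hk; omega
  simp [this]

lemma eval_one_homogPolylogPoly (hp : Odd p) :
    (homogPolylogPoly (p - 1) fun j => ((j : ZMod p))⁻¹).eval 1 = 0 := by
  rw [homogPolylogPoly, eval_finsetSum, ← sum_Icc_inv_eq_zero hp]
  refine Finset.sum_congr rfl fun k hk => ?_
  rw [Finset.mem_Icc] at hk
  have h : (1 - 2 : ZMod p) = -1 := by norm_num
  have hev : Even (p - 1) := hp.tsub_odd odd_one
  simp [h, ← pow_add, Nat.add_sub_cancel' hk.2, hev.neg_one_pow]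

lemma eval_one_polylogPoly (hp : Odd p) :
    (polylogPoly (p - 1) fun j => ((j : ZMod p))⁻¹).eval 1 = 0 := by
  rw [polylogPoly, eval_finsetSum, ← sum_Icc_inv_eq_zero hp]
  simp

/-! ### Differential equations modulo `p`. -/

lemma one_sub_two_mul_X_pow : (1 - 2 * X : (ZMod p)[X]) ^ p = 1 - 2 * X ^ p := by
  rw [sub_pow_char, one_pow, mul_pow]
  congr 2
  rw [← Nat.cast_ofNat, ← map_natCast (C : ZMod p →+* (ZMod p)[X]), ← C_pow, ZMod.pow_card]

lemma X_sub_one_mul_derivative_polylogPoly :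
    (X - 1) * derivative (polylogPoly (p - 1) fun j => ((j : ZMod p))⁻¹) = X ^ (p - 1) - 1 := by
  rw [← mul_geom_sum X (p - 1), polylogPoly, derivative_sum, ← Finset.Ico_add_one_right_eq_Icc,
    Finset.sum_Ico_eq_sum_range, Nat.add_sub_cancel]
  congr 1
  refine Finset.sum_congr rfl fun k hk => ?_
  rw [Finset.mem_range] at hk
  rw [derivative_C_mul_X_pow,
    inv_mul_cancel₀ (ZMod.natCast_ne_zero_of_pos_of_lt (by omega) (by omega)), C_1, one_mul,
    Nat.add_sub_cancel_left]

/-- The homogeneous geometric sum without its first term. -/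
lemma one_sub_X_mul_sum (hp : Odd p) :
    (1 - X) * ∑ k ∈ Icc 1 (p - 1), (-X : (ZMod p)[X]) ^ k * (1 - 2 * X) ^ (p - 1 - k)
      = 1 - X ^ p - (1 - 2 * X) ^ (p - 1) * (1 - X) := by
  have hpos := (Fact.out : p.Prime).pos
  have h := (Commute.all (-X : (ZMod p)[X]) (1 - 2 * X)).mul_geom_sum₂ p
  rw [hp.neg_pow, one_sub_two_mul_X_pow, Finset.range_eq_Ico, Finset.sum_eq_sum_Ico_succ_bot hpos,
    zero_add, pow_zero, one_mul, Nat.sub_zero] at h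
  rw [← Finset.Ico_add_one_right_eq_Icc, Nat.sub_add_cancel (show 1 ≤ p from hpos)]
  linear_combination -h

/-- Modulo `p`, `s ^ (p - 1 - k)` differentiates like `s ^ (-1 - k)`, so the two parts of each term
combine into a multiple of `k`, which cancels the coefficient `1/k`. -/
lemma derivative_homogPolylogPoly :
    X * ((1 - 2 * X) * derivative (homogPolylogPoly (p - 1) fun j => ((j : ZMod p))⁻¹)
      - 2 * homogPolylogPoly (p - 1) fun j => ((j : ZMod p))⁻¹)
      = ∑ k ∈ Icc 1 (p - 1), (-X : (ZMod p)[X]) ^ k * (1 - 2 * X) ^ (p - 1 - k) := by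
  simp only [homogPolylogPoly, derivative_sum, Finset.mul_sum, ← Finset.sum_sub_distrib]
  refine Finset.sum_congr rfl fun k hk => ?_
  rw [Finset.mem_Icc] at hk
  have hu : (C ((k : ZMod p)⁻¹) : (ZMod p)[X]) * (k : (ZMod p)[X]) = 1 := by
    rw [← map_natCast (C : ZMod p →+* (ZMod p)[X]), ← C_mul,
      inv_mul_cancel₀ (ZMod.natCast_ne_zero_of_pos_of_lt (by omega) (by omega)), C_1]
  obtain ⟨k, rfl⟩ := Nat.exists_eq_add_of_le' hk.1
  have hd : (1 - 2 * X : (ZMod p)[X]) * derivative ((1 - 2 * X : (ZMod p)[X]) ^ (p - 1 - (k + 1)))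
      = 2 * ((k + 1 : ℕ) + 1) * (1 - 2 * X : (ZMod p)[X]) ^ (p - 1 - (k + 1)) := by
    obtain ⟨j, hj⟩ := Nat.exists_eq_add_of_le hk.2
    have hc : ((k + 1 + j + 1 : ℕ) : (ZMod p)[X]) = 0 := by
      rw [show k + 1 + j + 1 = p by omega]
      exact CharP.cast_eq_zero _ _
    push_cast at hc
    rw [hj, Nat.add_sub_cancel_left]
    -- For exponent `0` the derivative is zero, and so is the factor on the right, since it is `2p`.
    rcases j with _ | j
    · simp only [pow_zero, derivative_one]
      push_cast at hc ⊢
      linear_combination -2 * hc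
    · rw [derivative_pow, Nat.add_sub_cancel, pow_succ _ j]
      simp only [derivative_sub, derivative_one, derivative_mul, derivative_ofNat, derivative_X,
        map_natCast]
      push_cast at hc ⊢
      linear_combination -2 * (1 - 2 * X) ^ j * (1 - 2 * X) * hc
  rw [derivative_C_mul, derivative_mul]
  simp only [derivative_pow (-X), derivative_neg, derivative_X, Nat.add_sub_cancel, map_natCast]
  set t := (1 - 2 * X : (ZMod p)[X]) ^ (p - 1 - (k + 1))
  linear_combination X * C (((k + 1 : ℕ) : ZMod p)⁻¹) * (-X) ^ (k + 1) * hd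
    + (-X) ^ (k + 1) * t * hu

/-- Truncated form of the differential equation given by `(k+1) a_{k+1} = (4k+2) a_k + binom(2k+2,
k+1)` for `a_k = binom(2k, k) H_k`; the last term is the truncation error. -/
lemma sum_centralBinom_mul_harmonic_recurrence (y : (ZMod p)[X]) {n : ℕ} (hn : n < p) :
    (1 - 4 * y) * ∑ k ∈ Icc 1 n, C (((2 * k).choose k : ℕ) *
        harmonicOf (fun j => ((j : ZMod p))⁻¹) k) * (k * y ^ k)
      - 2 * y * ∑ k ∈ Icc 1 n, C (((2 * k).choose k : ℕ) *
        harmonicOf (fun j => ((j : ZMod p))⁻¹) k) * y ^ k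
      = ∑ k ∈ Icc 1 n, C (((2 * k).choose k : ℕ) : ZMod p) * y ^ k
        - (4 * n + 2) * C (((2 * n).choose n : ℕ) *
          harmonicOf (fun j => ((j : ZMod p))⁻¹) n) * y ^ (n + 1) := by
  induction n with
  | zero => simp [harmonicOf]
  | succ n ih =>
    have hne := ZMod.natCast_ne_zero_of_pos_of_lt (p := p) n.succ_pos hn
    have hc := congrArg (Nat.cast : ℕ → ZMod p) (Nat.succ_mul_centralBinom_succ n)
    simp only [Nat.centralBinom] at hc
    have hh : harmonicOf (fun j => ((j : ZMod p))⁻¹) (n + 1)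
        = harmonicOf (fun j => ((j : ZMod p))⁻¹) n + ((n + 1 : ℕ) : ZMod p)⁻¹ :=
      Finset.sum_Icc_succ_top (by omega) _
    have ha : ((n + 1 : ℕ) : ZMod p) * (((2 * (n + 1)).choose (n + 1) : ℕ) *
        harmonicOf (fun j => ((j : ZMod p))⁻¹) (n + 1))
        = (4 * n + 2) * (((2 * n).choose n : ℕ) * harmonicOf (fun j => ((j : ZMod p))⁻¹) n)
          + ((2 * (n + 1)).choose (n + 1) : ℕ) := by
      rw [hh]
      have := mul_inv_cancel₀ hne
      push_cast at hc this ⊢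
      linear_combination (harmonicOf (fun j => ((j : ZMod p))⁻¹) n) * hc
        + ((2 * (n + 1)).choose (n + 1) : ZMod p) * this
    have ha' := congrArg (C : ZMod p →+* (ZMod p)[X]) ha
    rw [map_add, map_mul C ((n + 1 : ℕ) : ZMod p), map_mul C (4 * (n : ZMod p) + 2)] at ha'
    simp only [map_natCast, map_add C (4 * (n : ZMod p)), map_mul C (4 : ZMod p), map_ofNat] at ha'
    specialize ih (by omega)
    simp only [Finset.sum_Icc_succ_top (Nat.le_add_left 1 n)]
    simp only [map_natCast] at ih ⊢
    push_cast at ha' ⊢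
    linear_combination ih + y ^ (n + 1) * ha'

lemma sum_centralBinom_mod {m : ℕ} (hm : p = 2 * m + 1) (y : (ZMod p)[X]) :
    ∑ k ∈ Icc 1 (p - 1), C (((2 * k).choose k : ℕ) : ZMod p) * y ^ k = (1 - 4 * y) ^ m - 1 := by
  have h : ∑ k ∈ range p, C (((2 * k).choose k : ℕ) : ZMod p) * y ^ k = (1 - 4 * y) ^ m := by
    rw [sub_eq_neg_add, add_pow, ← Finset.sum_subset (Finset.range_mono (by omega : m + 1 ≤ p))]
    · refine Finset.sum_congr rfl fun k hk => ?_
      rw [Finset.mem_range] at hk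
      rw [centralBinom_eq_choose_mod hm (by omega), ← neg_mul, mul_pow]
      simp only [C_mul, C_pow, map_neg, map_ofNat, map_natCast, one_pow, mul_one]
      ring
    · intro k hk hk'
      rw [Finset.mem_range] at hk hk'
      rw [centralBinom_eq_zero_mod hm (by omega) hk, C_0, zero_mul]
  rw [Finset.range_eq_Ico, Finset.sum_eq_sum_Ico_succ_bot (by omega)] at h
  rw [← h, ← Finset.Ico_add_one_right_eq_Icc, Nat.sub_add_cancel (by omega)]
  simp

lemma derivative_centralBinomHarmonicPoly {m : ℕ} (hm : p = 2 * m + 1) :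
    X * (1 - X) *
      ((1 - 2 * X) * derivative (centralBinomHarmonicPoly (p - 1) fun j => ((j : ZMod p))⁻¹)
      - 2 * centralBinomHarmonicPoly (p - 1) fun j => ((j : ZMod p))⁻¹)
      = (1 - 2 * X) ^ (p - 1) - 1 := by
  have hp := (Fact.out : p.Prime).two_le
  have h := sum_centralBinom_mul_harmonic_recurrence (X * (1 - X) : (ZMod p)[X])
    (n := p - 1) (by omega)
  rw [sum_centralBinom_mod hm, centralBinom_eq_zero_mod (k := p - 1) hm (by omega) (by omega)] at h
  have hd : X * (1 - X) * derivative
      (centralBinomHarmonicPoly (p - 1) fun j => ((j : ZMod p))⁻¹)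
      = (1 - 2 * X) * ∑ k ∈ Icc 1 (p - 1), C (((2 * k).choose k : ℕ) *
        harmonicOf (fun j => ((j : ZMod p))⁻¹) k) * (k * (X * (1 - X) : (ZMod p)[X]) ^ k) := by
    rw [centralBinomHarmonicPoly, derivative_sum, Finset.mul_sum, Finset.mul_sum]
    refine Finset.sum_congr rfl fun k hk => ?_
    obtain ⟨k, rfl⟩ := Nat.exists_eq_add_of_le' (Finset.mem_Icc.1 hk).1
    rw [derivative_C_mul, derivative_pow, pow_succ _ k]
    simp only [derivative_mul, derivative_X, derivative_sub, derivative_one, map_natCast,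
      Nat.add_sub_cancel]
    ring
  have hs : (1 - 4 * (X * (1 - X)) : (ZMod p)[X]) = (1 - 2 * X) ^ 2 := by ring
  -- The truncation error disappears because `binom(2p-2, p-1)` is divisible by `p`.
  rw [hs, ← pow_mul, show 2 * m = p - 1 by omega, zero_mul, C_0, mul_zero, zero_mul, sub_zero] at h
  rw [← h, mul_sub, mul_left_comm, hd, ← centralBinomHarmonicPoly]
  ring

lemma derivative_catalanHarmonicPoly (n : ℕ) (u : ℕ → ZMod p) :
    derivative (catalanHarmonicPoly n u) = (1 - 2 * X) * centralBinomHarmonicPoly n u := by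
  simp only [catalanHarmonicPoly, centralBinomHarmonicPoly, derivative_sum, Finset.mul_sum]
  refine Finset.sum_congr rfl fun k _ => ?_
  have h := congrArg (Nat.cast : ℕ → (ZMod p)[X]) (succ_mul_catalan_eq_centralBinom k)
  rw [Nat.centralBinom] at h
  push_cast at h
  simp only [C_mul, map_natCast, derivative_mul, derivative_pow, ← h]
  simp
  ring

lemma X_mul_one_sub_X_ne_zero : (X * (1 - X) : (ZMod p)[X]) ≠ 0 := by
  refine mul_ne_zero X_ne_zero fun h => ?_
  simpa using congrArg (eval 0) h

/-! ### The two identities over `ZMod p`. -/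

theorem centralBinomHarmonicPoly_eq (hp : Odd p) :
    (centralBinomHarmonicPoly (p - 1) fun j => ((j : ZMod p))⁻¹)
      = -2 * homogPolylogPoly (p - 1) fun j => ((j : ZMod p))⁻¹ := by
  obtain ⟨m, hm⟩ := id hp
  have hF := derivative_centralBinomHarmonicPoly hm
  have hG := derivative_homogPolylogPoly (p := p)
  have hT := one_sub_X_mul_sum hp
  have hFd := natDegree_centralBinomHarmonicPoly_le hm
  have hGd := natDegree_homogPolylogPoly_le (p - 1) fun j => ((j : ZMod p))⁻¹
  have hF0 := eval_centralBinomHarmonicPoly_of_mul_eq_zero (n := p - 1)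
    (u := fun j => ((j : ZMod p))⁻¹) (a := 0) (by simp)
  have hF1 := eval_centralBinomHarmonicPoly_of_mul_eq_zero (n := p - 1)
    (u := fun j => ((j : ZMod p))⁻¹) (a := 1) (by simp)
  have hG0 := eval_zero_homogPolylogPoly (p - 1) fun j => ((j : ZMod p))⁻¹
  have hG1 := eval_one_homogPolylogPoly hp
  have hs := one_sub_two_mul_X_pow (p := p)
  have hp1 : (1 - 2 * X : (ZMod p)[X]) ^ p = (1 - 2 * X) ^ (p - 1) * (1 - 2 * X) := by
    rw [← pow_succ, Nat.sub_add_cancel (by omega)]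
  set F := centralBinomHarmonicPoly (p - 1) fun j => ((j : ZMod p))⁻¹
  set G := homogPolylogPoly (p - 1) fun j => ((j : ZMod p))⁻¹
  have hsne : (1 - 2 * X : (ZMod p)[X]) ≠ 0 := fun h => by simpa using congrArg (eval 0) h
  -- The factor `1 - 2X` turns the operator `s f' - 2f` of the differential equations into the
  -- derivative of `s f`.
  have key : (1 - 2 * X) * (F + 2 * G) = 0 := by
    apply eq_zero_of_derivative_eq_zero
    · refine (mul_eq_zero.1 (?_ : (X * (1 - X) : (ZMod p)[X]) * _ = 0)).resolve_left
        X_mul_one_sub_X_ne_zero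
      have : derivative ((1 - 2 * X) * (F + 2 * G))
          = (1 - 2 * X) * derivative F - 2 * F + 2 * ((1 - 2 * X) * derivative G - 2 * G) := by
        simp
        ring
      rw [this]
      linear_combination hF + 2 * (1 - X) * hG + 2 * hT + hp1 - hs
    · have h1 : (1 - 2 * X : (ZMod p)[X]).natDegree ≤ 1 := by compute_degree
      have h2 : (F + 2 * G).natDegree ≤ p - 1 := by
        refine natDegree_add_le_of_degree_le hFd ?_
        rw [← Nat.cast_ofNat, ← map_natCast (C : ZMod p →+* (ZMod p)[X])]
        exact (natDegree_C_mul_le _ _).trans hGd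
      have := natDegree_mul_le_of_le h1 h2
      omega
    · simp [hF0, hG0]
    · simp [hF1, hG1]
  linear_combination (mul_eq_zero.1 key).resolve_left hsne

theorem catalanHarmonicPoly_eq (hp : Odd p) :
    (catalanHarmonicPoly (p - 1) fun j => ((j : ZMod p))⁻¹)
      = (polylogPoly (p - 1) fun j => ((j : ZMod p))⁻¹)
        + (1 - 2 * X) ^ 2 * homogPolylogPoly (p - 1) fun j => ((j : ZMod p))⁻¹ := by
  obtain ⟨m, hm⟩ := id hp
  have hE := derivative_catalanHarmonicPoly (p - 1) fun j => ((j : ZMod p))⁻¹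
  rw [centralBinomHarmonicPoly_eq hp] at hE
  have hG := derivative_homogPolylogPoly (p := p)
  have hL := X_sub_one_mul_derivative_polylogPoly (p := p)
  have hT := one_sub_X_mul_sum hp
  have hEd := natDegree_catalanHarmonicPoly_le hm
  have hGd := natDegree_homogPolylogPoly_le (p - 1) fun j => ((j : ZMod p))⁻¹
  have hLd := natDegree_polylogPoly_le (p - 1) fun j => ((j : ZMod p))⁻¹
  have hE0 := eval_catalanHarmonicPoly_of_mul_eq_zero (n := p - 1)
    (u := fun j => ((j : ZMod p))⁻¹) (a := 0) (by simp)
  have hE1 := eval_catalanHarmonicPoly_of_mul_eq_zero (n := p - 1)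
    (u := fun j => ((j : ZMod p))⁻¹) (a := 1) (by simp)
  have hG0 := eval_zero_homogPolylogPoly (p - 1) fun j => ((j : ZMod p))⁻¹
  have hG1 := eval_one_homogPolylogPoly hp
  have hL0 := eval_zero_polylogPoly (p - 1) fun j => ((j : ZMod p))⁻¹
  have hL1 := eval_one_polylogPoly hp
  have hs := one_sub_two_mul_X_pow (p := p)
  have hp2 : 2 < p := by
    have := (Fact.out : p.Prime).two_le
    omega
  have hp1 : (1 - 2 * X : (ZMod p)[X]) ^ p = (1 - 2 * X) ^ (p - 1) * (1 - 2 * X) := by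
    rw [← pow_succ, Nat.sub_add_cancel (by omega)]
  have hX : (X : (ZMod p)[X]) ^ p = X ^ (p - 1) * X := by
    rw [← pow_succ, Nat.sub_add_cancel (by omega)]
  set E := catalanHarmonicPoly (p - 1) fun j => ((j : ZMod p))⁻¹
  set G := homogPolylogPoly (p - 1) fun j => ((j : ZMod p))⁻¹
  set L := polylogPoly (p - 1) fun j => ((j : ZMod p))⁻¹
  rw [← sub_eq_zero]
  apply eq_zero_of_derivative_eq_zero
  · refine (mul_eq_zero.1 (?_ : (X * (1 - X) : (ZMod p)[X]) * _ = 0)).resolve_left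
        X_mul_one_sub_X_ne_zero
    have : derivative (E - (L + (1 - 2 * X) ^ 2 * G))
        = derivative E - derivative L + 4 * (1 - 2 * X) * G - (1 - 2 * X) ^ 2 * derivative G := by
      rw [pow_two]
      simp
      ring
    rw [this, hE]
    linear_combination X * hL - (1 - X) * (1 - 2 * X) * hG - (1 - 2 * X) * hT
      + (1 - X) * (hs - hp1) - hX
  · have h1 : ((1 - 2 * X : (ZMod p)[X]) ^ 2).natDegree ≤ 2 := by compute_degree
    have h2 := natDegree_mul_le_of_le h1 hGd
    have h3 : (E - (L + (1 - 2 * X) ^ 2 * G)).natDegree ≤ p + 1 :=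
      (natDegree_sub_le_of_le hEd
        (natDegree_add_le_of_degree_le (hLd.trans (by omega : p - 1 ≤ p + 1))
          (h2.trans (by omega : 2 + (p - 1) ≤ p + 1)))).trans_eq (max_self _)
    -- The bound `p + 1 < 2p` holds because `p > 2`.
    omega
  · simp [hE0, hL0, hG0]
  · simp [hE1, hL1, hG1]

end ModP

/-! ### Return to `ℤ_p[β]` and `ℚ_p(β)`. -/

section Lift

variable {R K : Type*} [CommRing R] [Field K]

lemma map_harmonicOf_eq_harmonic [CharZero K] (φ : R →+* K) (u : ℕ → R) (n k : ℕ) (hk : k ≤ n)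
    (h : ∀ j ∈ Icc 1 n, φ (u j) = (j : K)⁻¹) : φ (harmonicOf u k) = ((harmonic k : ℚ) : K) := by
  rw [map_harmonicOf φ u _ n k hk h, harmonicOf, harmonic_eq_sum_Icc]
  push_cast
  rfl

end Lift

variable {p : ℕ} [Fact p.Prime]

lemma padicInt_natCast_mul_inv {j : ℕ} (hj : j ∈ Icc 1 (p - 1)) :
    (j : ℤ_[p]) * (j : ℤ_[p]).inv = 1 := by
  rw [Finset.mem_Icc] at hj
  apply PadicInt.mul_inv
  rw [PadicInt.norm_natCast_eq_one_iff]
  exact (Fact.out : p.Prime).coprime_iff_not_dvd.2 (Nat.not_dvd_of_pos_of_lt hj.1 (by omega))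

/-- The kernel of `PadicInt.toZMod` is generated by `p`, and divisibility by a constant is checked
on coefficients. -/
lemma dvd_sub_of_map_toZMod_eq {a b : ℤ_[p][X]}
    (h : a.map (PadicInt.toZMod (p := p)) = b.map PadicInt.toZMod) : (p : ℤ_[p][X]) ∣ a - b := by
  rw [← map_natCast (C : ℤ_[p] →+* ℤ_[p][X]), C_dvd_iff_dvd_coeff]
  intro i
  rw [← Ideal.mem_span_singleton, ← PadicInt.maximalIdeal_eq_span_p, ← PadicInt.ker_toZMod,
    RingHom.mem_ker, coeff_sub, map_sub, ← coeff_map, ← coeff_map, h, sub_self]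

lemma padicPolyEmb_X : padicPolyEmb p X = RatFunc.X := by
  simp [padicPolyEmb]

lemma padicPolyEmb_C_inv {j : ℕ} (hj : j ∈ Icc 1 (p - 1)) :
    ((padicPolyEmb p).comp C) ((j : ℤ_[p]).inv) = (j : RatFunc ℚ_[p])⁻¹ := by
  apply eq_inv_of_mul_eq_one_right
  have := congrArg ((padicPolyEmb p).comp C) (padicInt_natCast_mul_inv hj)
  rwa [map_mul, map_natCast, map_one] at this

lemma toZMod_inv {j : ℕ} (hj : j ∈ Icc 1 (p - 1)) :
    PadicInt.toZMod ((j : ℤ_[p]).inv) = (j : ZMod p)⁻¹ := by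
  apply eq_inv_of_mul_eq_one_right
  have := congrArg (PadicInt.toZMod (p := p)) (padicInt_natCast_mul_inv hj)
  rwa [map_mul, map_natCast, map_one] at this

lemma padicPolyEmb_centralBinomHarmonicPoly :
    padicPolyEmb p (centralBinomHarmonicPoly (p - 1) fun j => (j : ℤ_[p]).inv)
      = ∑ k ∈ Icc 1 (p - 1), (((2 * k).choose k : ℕ) : RatFunc ℚ_[p])
        * ((harmonic k : ℚ) : RatFunc ℚ_[p]) * (RatFunc.X * (1 - RatFunc.X)) ^ k := by
  rw [centralBinomHarmonicPoly, map_sum]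
  refine Finset.sum_congr rfl fun k hk => ?_
  have := map_harmonicOf_eq_harmonic ((padicPolyEmb p).comp C) _ (p - 1) k
    (Finset.mem_Icc.1 hk).2 fun j => padicPolyEmb_C_inv
  rw [RingHom.comp_apply] at this
  simp [this, padicPolyEmb_X]

lemma padicPolyEmb_catalanHarmonicPoly :
    padicPolyEmb p (catalanHarmonicPoly (p - 1) fun j => (j : ℤ_[p]).inv)
      = ∑ k ∈ Icc 1 (p - 1), ((catalan k : ℕ) : RatFunc ℚ_[p])
        * ((harmonic k : ℚ) : RatFunc ℚ_[p]) * (RatFunc.X * (1 - RatFunc.X)) ^ (k + 1) := by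
  rw [catalanHarmonicPoly, map_sum]
  refine Finset.sum_congr rfl fun k hk => ?_
  have := map_harmonicOf_eq_harmonic ((padicPolyEmb p).comp C) _ (p - 1) k
    (Finset.mem_Icc.1 hk).2 fun j => padicPolyEmb_C_inv
  rw [RingHom.comp_apply] at this
  simp [this, padicPolyEmb_X]

lemma padicPolyEmb_polylogPoly :
    padicPolyEmb p (polylogPoly (p - 1) fun j => (j : ℤ_[p]).inv)
      = finitePolylog p 1 RatFunc.X := by
  rw [polylogPoly, finitePolylog, map_sum]
  refine Finset.sum_congr rfl fun k hk => ?_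
  have := padicPolyEmb_C_inv hk
  rw [RingHom.comp_apply] at this
  rw [map_mul, this, map_pow, padicPolyEmb_X, pow_one, div_eq_inv_mul]

lemma one_sub_two_mul_ratFuncX_ne_zero : (1 - 2 * RatFunc.X : RatFunc ℚ_[p]) ≠ 0 := by
  intro h
  have h' : algebraMap ℚ_[p][X] (RatFunc ℚ_[p]) (1 - 2 * X) = 0 := by simpa [map_ofNat] using h
  rw [map_eq_zero_iff _ (RatFunc.algebraMap_injective _)] at h'
  simpa using congrArg (eval 0) h'

lemma padicPolyEmb_homogPolylogPoly :
    padicPolyEmb p (homogPolylogPoly (p - 1) fun j => (j : ℤ_[p]).inv)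
      = (1 - 2 * RatFunc.X) ^ (p - 1)
        * finitePolylog p 1 (RatFunc.X / (RatFunc.X - (1 - RatFunc.X))) := by
  rw [homogPolylogPoly, finitePolylog, map_sum, Finset.mul_sum]
  refine Finset.sum_congr rfl fun k hk => ?_
  have := padicPolyEmb_C_inv hk
  rw [RingHom.comp_apply] at this
  have hs := one_sub_two_mul_ratFuncX_ne_zero (p := p)
  have hx : (RatFunc.X / (RatFunc.X - (1 - RatFunc.X)) : RatFunc ℚ_[p])
      = (-RatFunc.X) / (1 - 2 * RatFunc.X) := by
    rw [← neg_div_neg_eq]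
    congr 1
    ring
  rw [Finset.mem_Icc] at hk
  rw [hx, div_pow, map_mul, this, pow_one, ← Nat.sub_add_cancel hk.2, Nat.add_sub_cancel, pow_add]
  simp only [map_mul, map_pow, map_neg, map_sub, map_one, map_ofNat, padicPolyEmb_X]
  have := pow_ne_zero k hs
  generalize (1 - 2 * RatFunc.X : RatFunc ℚ_[p]) = s at *
  field_simp

theorem mainTheorem2 (p : ℕ) [Fact p.Prime] (hp : Odd p)
    (α β x : RatFunc ℚ_[p]) (hβ : β = RatFunc.X) (hα : α = 1 - β) (hx : x = β * (1 - β)) :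
    PolyCongr p
      (∑ k ∈ Icc 1 (p - 1),
        (((2 * k).choose k : ℕ) : RatFunc ℚ_[p]) * ((harmonic k : ℚ) : RatFunc ℚ_[p]) * x ^ k)
      (-2 * (α - β) ^ (p - 1) * finitePolylog p 1 (β / (β - α))) ∧
    PolyCongr p
      (∑ k ∈ Icc 1 (p - 1),
        ((catalan k : ℕ) : RatFunc ℚ_[p]) * ((harmonic k : ℚ) : RatFunc ℚ_[p]) * x ^ (k + 1))
      (finitePolylog p 1 β + (α - β) ^ (p + 1) * finitePolylog p 1 (β / (β - α))) := by
  subst hx hα hβ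
  have hs : (1 - RatFunc.X - RatFunc.X : RatFunc ℚ_[p]) = 1 - 2 * RatFunc.X := by ring
  have hp1 : p + 1 = 2 + (p - 1) := by
    have := (Fact.out : p.Prime).two_le
    omega
  have hG := map_homogPolylogPoly (PadicInt.toZMod (p := p)) _ _ (p - 1) fun j => toZMod_inv
  refine ⟨⟨_, -2 * homogPolylogPoly (p - 1) fun j => (j : ℤ_[p]).inv,
    padicPolyEmb_centralBinomHarmonicPoly, ?_, dvd_sub_of_map_toZMod_eq ?_⟩,
    ⟨_, (polylogPoly (p - 1) fun j => (j : ℤ_[p]).inv)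
      + (1 - 2 * X) ^ 2 * homogPolylogPoly (p - 1) fun j => (j : ℤ_[p]).inv,
    padicPolyEmb_catalanHarmonicPoly, ?_, dvd_sub_of_map_toZMod_eq ?_⟩⟩
  · rw [map_mul, padicPolyEmb_homogPolylogPoly, hs, mul_assoc]
    simp [map_ofNat]
  · rw [map_centralBinomHarmonicPoly _ _ _ _ fun j => toZMod_inv, centralBinomHarmonicPoly_eq hp,
      Polynomial.map_mul, hG]
    simp
  · rw [map_add, map_mul, padicPolyEmb_homogPolylogPoly, padicPolyEmb_polylogPoly, hs, hp1,
      pow_add, mul_assoc]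
    simp [padicPolyEmb_X, map_ofNat]
  · rw [map_catalanHarmonicPoly _ _ _ _ fun j => toZMod_inv, catalanHarmonicPoly_eq hp,
      Polynomial.map_add, Polynomial.map_mul, hG,
      map_polylogPoly _ _ _ _ fun j => toZMod_inv]
    simp
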